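/- For even integers $n$ and $j$, the $(0,j)$-prism $Pr_n(0,j)$ is the graph on the $2n$ vertices $v_a^1, v_a^2$ ($a\in\mathbb{Z}/n$) consisting of the two rims $v_0^i v_1^i\cdots v_{n-1}^i v_0^i$, $i\in\{1,2\}$ (cycles of length $n$), the edges $v_a^1v_a^2$ for even $a$, and the edges $v_a^1v_{a+j}^2$ for odd $a$ (indices modulo $n$). An acyclic coloring of a graph $G$ is a proper vertex coloring in which the vertices of any two colors induce a forest. An acyclic recoloring step chooses a color $i$ and recolors every vertex of color $i$ with some other color of the given coloring (possibly different ones for different vertices), keeping the colors of all other vertices, so that the result is again an acyclic coloring. The acyclic b-chromatic number $A_b(G)$ of a finite graph $G$ is the maximum number of colors in an acyclic coloring of $G$ from which no acyclic recoloring step is possible. Theorem. Let $n$ and $j$ be even integers with $j>0$ and $n\ge 5(j+2)$. Then $A_b(Pr_n(0,j))=5$. -/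

import Mathlib

/-- The adjacency of the `(0,j)`-prism with rims of length `n`, each edge listed in one direction.
The vertex `(0, a)` is `v_a^1` and `(1, a)` is `v_a^2`; upper indices are read modulo `n`. -/
inductive PrismEdge (n j : ℕ) : Fin 2 × ZMod n → Fin 2 × ZMod n → Prop
  /-- edges of the two rims -/
  | rim (i : Fin 2) (a : ZMod n) : PrismEdge n j (i, a) (i, a + 1)
  /-- spokes of type `0`, at the even indices -/
  | spokeZero (a : ZMod n) (ha : Even a.val) : PrismEdge n j (0, a) (1, a)
  /-- spokes of type `j`, at the odd indices -/
  | spokeJ (a : ZMod n) (ha : Odd a.val) : PrismEdge n j (0, a) (1, a + (j : ZMod n))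

/-- The `(0,j)`-prism `Pr_n(0,j)`, of order `2n` (meant for even `n ≥ 3` and even `j`). -/
def zeroPrism (n j : ℕ) : SimpleGraph (Fin 2 × ZMod n) :=
  SimpleGraph.fromRel (PrismEdge n j)

/-- `c` is an acyclic coloring: it is proper, and any two color classes induce a forest. -/
def IsAcyclicColoring {V α : Type*} (G : SimpleGraph V) (c : V → α) : Prop :=
  (∀ u v, G.Adj u v → c u ≠ c v) ∧
    ∀ i j : α, (G.induce {v | c v = i ∨ c v = j}).IsAcyclic

/-- `c'` arises from `c` by an acyclic recoloring step that removes the color `i`: every vertex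
of color `i` gets another color (possibly different ones for different vertices), all other
vertices keep their color, and the result is again an acyclic coloring. -/
def IsAcyclicRecoloringStep {V α : Type*} (G : SimpleGraph V) (c : V → α) (i : α)
    (c' : V → α) : Prop :=
  (∀ v, c v ≠ i → c' v = c v) ∧ (∀ v, c' v ≠ i) ∧ IsAcyclicColoring G c'

/-- `c` is an acyclic coloring from which no acyclic recoloring step is possible. Every color is
then used, since an unused color is removed by the step that changes nothing. -/
def IsAcyclicBColoring {V α : Type*} (G : SimpleGraph V) (c : V → α) : Prop :=
  IsAcyclicColoring G c ∧ ∀ (i : α) (c' : V → α), ¬ IsAcyclicRecoloringStep G c i c'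

/-- The acyclic b-chromatic number `A_b(G)` of a finite graph: the maximum number of colors in an
acyclic coloring from which no acyclic recoloring step is possible. -/
noncomputable def acyclicBChromaticNumber {V : Type*} (G : SimpleGraph V) : ℕ :=
  sSup {k : ℕ | ∃ c : V → Fin k, IsAcyclicBColoring G c}

/-!
The prism is cubic, and on a cubic graph a coloring with six or more colors always admits a
recoloring step: the vertices of the color to be removed can be recolored one after the other. For
a single vertex `v` a new color is harmless unless it appears on a neighbor of `v` or lies beyond
two neighbors of `v` that share a color, since a two-colored cycle through `v` has to leave `v`
through two such neighbors. A count over the at most three neighbors shows that at most four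
colors are excluded in this way (`exists_blocked_colors`), so with the old color of `v` at most
five. Hence `IsAcyclicBColoring.card_le_five`.

For the lower bound the columns are cut into five blocks of even width at least `j + 2`. Within a
block the colors are distributed by role; position is counted from the left, and the last two
entries are repeated up to the end of the block:

* first rim: `3 2 1 0 1 0 …`
* second rim: `2 3 2 4 2 4 …`

The vertex of role `1` at position `2` has two neighbors of role `2`, which are joined by a path
with roles `2, 3` around a hexagon and by a path with roles `2, 4` along the second rim and back
through a spoke of type `j`. Its third neighbor has role `0`. So its color cannot be
removed (`prismColoring_not_step`). From one block to the next every color moves on from role `r`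
to role `r + 1` modulo `5`, so that after five blocks each color has had role `1`.

That the coloring is acyclic is certified by one rank function for all pairs of colors: whenever
two neighbors of a vertex have the same color, one of them has lower rank than the vertex. A
two-colored cycle would violate this at its vertex of lowest rank
(`isAcyclicColoring_of_rank`, `prismColoring_rank`).
-/

/-! ### Cycles in induced subgraphs -/

/-- The vertex set of a cycle inside `s`: it still carries a cycle, and each of its vertices has
two distinct neighbors in it. -/
lemma exists_cyclic_subset {V : Type*} {G : SimpleGraph V} {s : Set V}
    (h : ¬ (G.induce s).IsAcyclic) :
    ∃ S ⊆ s, S.Finite ∧ S.Nonempty ∧ ¬ (G.induce S).IsAcyclic ∧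
      ∀ x ∈ S, ∃ y ∈ S, ∃ z ∈ S, y ≠ z ∧ G.Adj x y ∧ G.Adj x z := by
  classical
  simp only [SimpleGraph.IsAcyclic, not_forall, not_not] at h
  obtain ⟨v, w, hw⟩ := h
  let f := (SimpleGraph.Embedding.induce (G := G) s).toHom
  have hf : Function.Injective f := (SimpleGraph.Embedding.induce (G := G) s).injective
  have hcyc : (w.map f).IsCycle := hw.map hf
  refine ⟨{x | x ∈ (w.map f).support}, ?_, List.finite_toSet _,
    ⟨f v, SimpleGraph.Walk.start_mem_support _⟩, ?_, ?_⟩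
  · intro x hx
    simp only [Set.mem_ofPred_eq, SimpleGraph.Walk.support_map, List.mem_map] at hx
    obtain ⟨y, -, rfl⟩ := hx
    exact y.2
  · intro hac
    refine hac ((w.map f).induce {x | x ∈ (w.map f).support} (fun x hx => hx)) ?_
    apply SimpleGraph.Walk.IsCycle.of_map
      (f := (SimpleGraph.Embedding.induce (G := G) {x | x ∈ (w.map f).support}).toHom)
    rw [SimpleGraph.Walk.map_induce]
    exact hcyc
  · intro x hx
    have hr := hcyc.rotate (u := x) hx
    have hmem : ∀ y, y ∈ ((w.map f).rotate (u := x) hx).support → y ∈ (w.map f).support :=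
      fun y hy => by
        simpa using hy
    exact ⟨_, hmem _ (SimpleGraph.Walk.getVert_mem_support _ _), _,
      hmem _ (SimpleGraph.Walk.getVert_mem_support _ _), hr.snd_ne_penultimate,
      SimpleGraph.Walk.adj_snd hr.not_nil, (SimpleGraph.Walk.adj_penultimate hr.not_nil).symm⟩

lemma isAcyclic_induce_mono {V : Type*} {G : SimpleGraph V} {s t : Set V} (hst : s ⊆ t)
    (h : (G.induce t).IsAcyclic) : (G.induce s).IsAcyclic :=
  h.embedding (G.induceHomOfLE hst)

/-- A path in `s` that avoids `v` and joins two neighbors of `v` closes up to a cycle. -/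
lemma not_isAcyclic_induce_of_reachable {V : Type*} {G : SimpleGraph V} {s : Set V} {v t u : V}
    (hv : v ∈ s) (ht : t ∈ s \ {v}) (hu : u ∈ s \ {v}) (hvt : G.Adj v t) (hvu : G.Adj v u)
    (htu : t ≠ u) (h : (G.induce (s \ {v})).Reachable ⟨t, ht⟩ ⟨u, hu⟩) :
    ¬ (G.induce s).IsAcyclic := by
  intro hac
  rw [SimpleGraph.isAcyclic_iff_forall_adj_isBridge] at hac
  have hb := hac (v := ⟨v, hv⟩) (w := ⟨t, ht.1⟩) hvt
  rw [SimpleGraph.isBridge_iff] at hb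
  let H := G.induce s \ SimpleGraph.fromEdgeSet {s((⟨v, hv⟩ : s), (⟨t, ht.1⟩ : s))}
  let f : G.induce (s \ {v}) →g H :=
    { toFun := fun x => ⟨x.1, x.2.1⟩
      map_rel' := by
        rintro ⟨x, hx, hxv⟩ ⟨y, hy, hyv⟩ hxy
        have hxy' : G.Adj x y := hxy
        simp only [Set.mem_singleton_iff] at hxv hyv
        simp [H, hxy', hxv, hyv] }
  have h1 : H.Reachable ⟨t, ht.1⟩ ⟨u, hu.1⟩ := h.map f
  have h2 : H.Adj ⟨v, hv⟩ ⟨u, hu.1⟩ := by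
    simp [H, hvu, htu.symm, hvt.ne]
  exact hb (h2.reachable.trans h1.symm)

/-- A rank function certifies acyclicity: the lowest vertex of a two-colored cycle would have two
neighbors of one color, neither of them of lower rank. -/
lemma isAcyclicColoring_of_rank {V α : Type*} {G : SimpleGraph V} (c : V → α) (f : V → ℕ)
    (hc : ∀ u v, G.Adj u v → c u ≠ c v)
    (hf : ∀ v u w, G.Adj v u → G.Adj v w → u ≠ w → c u = c w → f u < f v ∨ f w < f v) :
    IsAcyclicColoring G c := by
  refine ⟨hc, fun p q => ?_⟩
  by_contra hcyc
  obtain ⟨S, hS, hfin, hne, -, h2⟩ := exists_cyclic_subset hcyc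
  obtain ⟨x, hx, hmin⟩ := Set.exists_min_image S f hfin hne
  obtain ⟨y, hy, z, hz, hyz, hxy, hxz⟩ := h2 x hx
  have hcol : c y = c z := by
    have h1 := hS hx
    have h2 := hS hy
    have h3 := hS hz
    have h4 := hc _ _ hxy
    have h5 := hc _ _ hxz
    simp only [Set.mem_ofPred_eq] at h1 h2 h3
    grind
  rcases hf x y z hxy hxz hyz hcol with h | h
  · exact absurd (hmin y hy) (by omega)
  · exact absurd (hmin z hz) (by omega)

/-! ### At most five colors on a graph with at most three neighbors per vertex -/

/-- The elements lying in at least two of three sets of size at most two number at most three. -/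
lemma card_pairwise_inter_le_three {α : Type*} [DecidableEq α] {A B C : Finset α}
    (hA : A.card ≤ 2) (hB : B.card ≤ 2) (hC : C.card ≤ 2) :
    (A ∩ B ∪ (A ∩ C ∪ B ∩ C)).card ≤ 3 := by
  have hsum := Finset.card_union_add_card_inter A B
  by_cases h : (A ∩ B).card ≤ 1
  · calc (A ∩ B ∪ (A ∩ C ∪ B ∩ C)).card ≤ (A ∩ B ∪ C).card :=
          Finset.card_le_card (by grind)
      _ ≤ (A ∩ B).card + C.card := Finset.card_union_le _ _
      _ ≤ 3 := by omega
  · calc (A ∩ B ∪ (A ∩ C ∪ B ∩ C)).card ≤ (A ∪ B).card :=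
          Finset.card_le_card (by grind)
      _ ≤ 3 := by omega

/-- The colors that recoloring `v` must avoid, other than its own: the colors of its neighbors, and
those occurring beyond each of two equally colored neighbors. There are at most four. -/
lemma exists_blocked_colors {V α : Type*} [DecidableEq α] {G : SimpleGraph V}
    (hG : ∀ v, ∃ x y z, ∀ w, G.Adj v w ↔ w = x ∨ w = y ∨ w = z) (c : V → α) (v : V) :
    ∃ B : Finset α, B.card ≤ 4 ∧ (∀ u, G.Adj v u → c u ∈ B) ∧
      ∀ u w u' w', G.Adj v u → G.Adj v w → u ≠ w → c u = c w → G.Adj u u' → G.Adj w w' →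
        u' ≠ v → w' ≠ v → c u' = c w' → c u' ∈ B := by
  have hbeyond : ∀ u, G.Adj v u →
      ∃ A : Finset α, A.card ≤ 2 ∧ ∀ u', G.Adj u u' → u' ≠ v → c u' ∈ A := by
    intro u huv
    obtain ⟨x, y, z, h⟩ := hG u
    rcases (h v).1 huv.symm with rfl | rfl | rfl
    · exact ⟨{c y, c z}, Finset.card_le_two, by grind⟩
    · exact ⟨{c x, c z}, Finset.card_le_two, by grind⟩
    · exact ⟨{c x, c y}, Finset.card_le_two, by grind⟩
  obtain ⟨x, y, z, h⟩ := hG v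
  obtain ⟨X, hX, hX'⟩ := hbeyond x ((h x).2 (by simp))
  obtain ⟨Y, hY, hY'⟩ := hbeyond y ((h y).2 (by simp))
  obtain ⟨Z, hZ, hZ'⟩ := hbeyond z ((h z).2 (by simp))
  by_cases hxy : c x = c y
  · by_cases hyz : c y = c z
    · refine ⟨insert (c x) (X ∩ Y ∪ (X ∩ Z ∪ Y ∩ Z)), ?_, by grind, by grind⟩
      have := card_pairwise_inter_le_three hX hY hZ
      exact (Finset.card_insert_le _ _).trans (by omega)
    · refine ⟨insert (c x) (insert (c z) X), ?_, by grind, by grind⟩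
      exact (Finset.card_insert_le _ _).trans
        (by have := Finset.card_insert_le (c z) X; omega)
  · by_cases hyz : c y = c z
    · refine ⟨insert (c x) (insert (c z) Y), ?_, by grind, by grind⟩
      exact (Finset.card_insert_le _ _).trans
        (by have := Finset.card_insert_le (c z) Y; omega)
    · by_cases hxz : c x = c z
      · refine ⟨insert (c x) (insert (c y) X), ?_, by grind, by grind⟩
        exact (Finset.card_insert_le _ _).trans
          (by have := Finset.card_insert_le (c y) X; omega)
      · refine ⟨{c x, c y, c z}, Finset.card_le_three.trans (by omega), by grind, by grind⟩

/-- With six or more colors, a single vertex can always be recolored. -/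
lemma exists_update_isAcyclicColoring {V : Type*} [DecidableEq V] {G : SimpleGraph V}
    (hG : ∀ v, ∃ x y z, ∀ w, G.Adj v w ↔ w = x ∨ w = y ∨ w = z) {k : ℕ} (hk : 6 ≤ k)
    {c : V → Fin k} (hc : IsAcyclicColoring G c) (v : V) :
    ∃ q, q ≠ c v ∧ IsAcyclicColoring G (Function.update c v q) := by
  obtain ⟨B, hB, hB1, hB2⟩ := exists_blocked_colors hG c v
  obtain ⟨q, -, hq⟩ : ∃ q ∈ (Finset.univ : Finset (Fin k)), q ∉ insert (c v) B := by
    apply Finset.exists_mem_notMem_of_card_lt_card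
    have := Finset.card_insert_le (c v) B
    simp
    omega
  simp only [Finset.mem_insert, not_or] at hq
  refine ⟨q, hq.1, ?_⟩
  have hself : Function.update c v q v = q := by simp
  have hne : ∀ x, x ≠ v → Function.update c v q x = c x := fun x hx => by simp [hx]
  generalize Function.update c v q = c' at *
  have hproper : ∀ u w, G.Adj u w → c' u ≠ c' w := by
    intro u w huw
    by_cases hu : u = v
    · subst hu
      rw [hself, hne w huw.ne']
      exact fun h => hq.2 (h ▸ hB1 w huw)
    · by_cases hw : w = v
      · subst hw
        rw [hself, hne u hu]
        exact fun h => hq.2 (h ▸ hB1 u huw.symm)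
      · rw [hne u hu, hne w hw]
        exact hc.1 u w huw
  refine ⟨hproper, fun p r => ?_⟩
  by_contra hcyc
  obtain ⟨S, hS, -, -, hScyc, h2⟩ := exists_cyclic_subset hcyc
  -- A cycle through `v` leaves it through two neighbors of one color, and the vertices after these
  -- have the new color of `v`, which was blocked. A cycle avoiding `v` was there before.
  by_cases hv : v ∈ S
  · obtain ⟨y, hy, z, hz, hyz, hvy, hvz⟩ := h2 v hv
    have hbeyond : ∀ u ∈ S, G.Adj v u → ∃ u', G.Adj u u' ∧ u' ≠ v ∧ c u' = q := by
      intro u hu hvu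
      obtain ⟨s, hs, t, ht, hst, hus, hut⟩ := h2 u hu
      obtain ⟨u', hu', huu', huv⟩ : ∃ u' ∈ S, G.Adj u u' ∧ u' ≠ v := by grind
      refine ⟨u', huu', huv, ?_⟩
      have h1 := hproper _ _ hvu
      have h2 := hproper _ _ huu'
      have h3 := hS hv
      have h4 := hS hu
      have h5 := hS hu'
      simp only [Set.mem_ofPred_eq] at h3 h4 h5
      have := hne u' huv
      grind
    obtain ⟨y', hyy', hy'v, hy'q⟩ := hbeyond y hy hvy
    obtain ⟨z', hzz', hz'v, hz'q⟩ := hbeyond z hz hvz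
    have hcol : c y = c z := by
      have h1 := hproper _ _ hvy
      have h2 := hproper _ _ hvz
      have h3 := hS hv
      have h4 := hS hy
      have h5 := hS hz
      simp only [Set.mem_ofPred_eq] at h3 h4 h5
      have := hne y hvy.ne'
      have := hne z hvz.ne'
      grind
    have := hB2 y z y' z' hvy hvz hyz hcol hyy' hzz' hy'v hz'v (hy'q.trans hz'q.symm)
    exact hq.2 (hy'q ▸ this)
  · refine hScyc (isAcyclic_induce_mono (fun x hx => ?_) (hc.2 p r))
    have := hS hx
    rwa [Set.mem_ofPred_eq, hne x (fun h => hv (h ▸ hx))] at this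

/-- Recoloring its vertices one after the other removes a color when there are at least six. -/
lemma exists_isAcyclicRecoloringStep {V : Type*} [Finite V] {G : SimpleGraph V}
    (hG : ∀ v, ∃ x y z, ∀ w, G.Adj v w ↔ w = x ∨ w = y ∨ w = z) {k : ℕ} (hk : 6 ≤ k)
    (i : Fin k) {c : V → Fin k} (hc : IsAcyclicColoring G c) :
    ∃ c', IsAcyclicRecoloringStep G c i c' := by
  classical
  induction h : {v | c v = i}.ncard generalizing c with
  | zero =>
    rw [Set.ncard_eq_zero] at h
    exact ⟨c, fun _ _ => rfl, fun v hv => (h ▸ hv : v ∈ (∅ : Set V)), hc⟩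
  | succ m ih =>
    obtain ⟨v, hv⟩ : {v | c v = i}.Nonempty := by
      rw [← Set.ncard_pos]; omega
    obtain ⟨q, hq, hcq⟩ := exists_update_isAcyclicColoring hG hk hc v
    have hcv : c v = i := hv
    have hset : {x | Function.update c v q x = i} = {x | c x = i} \ {v} := by
      ext x
      by_cases hx : x = v
      · subst hx; simp [hcv ▸ hq]
      · simp [hx]
    obtain ⟨c', h1, h2, h3⟩ := ih hcq (by
      rw [hset, Set.ncard_sdiff_singleton_of_mem hv, h]; rfl)
    refine ⟨c', fun x hx => ?_, h2, h3⟩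
    have hxv : x ≠ v := fun h => hx (h ▸ hcv)
    have := h1 x (by simpa [hxv] using hx)
    simpa [hxv] using this

lemma IsAcyclicBColoring.card_le_five {V : Type*} [Finite V] {G : SimpleGraph V}
    (hG : ∀ v, ∃ x y z, ∀ w, G.Adj v w ↔ w = x ∨ w = y ∨ w = z) {k : ℕ} {c : V → Fin k}
    (hc : IsAcyclicBColoring G c) : k ≤ 5 := by
  by_contra! hk
  obtain ⟨c', hc'⟩ := exists_isAcyclicRecoloringStep hG hk ⟨0, by omega⟩ hc.1
  exact hc.2 _ _ hc'

/-! ### The prism in block coordinates -/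

/-- The number of the block that contains column `m`: four blocks of `j + 2` columns each, and a
fifth one with the remaining columns. -/
def columnBlock (j m : ℕ) : Fin 5 :=
  if m < j + 2 then 0 else if m < 2 * (j + 2) then 1 else if m < 3 * (j + 2) then 2
  else if m < 4 * (j + 2) then 3 else 4

/-- The first column of a block. -/
def blockStart (j : ℕ) (k : Fin 5) : ℕ := k.val * (j + 2)

/-- The position of column `m` within its block. -/
def columnOffset (j m : ℕ) : ℕ := m - blockStart j (columnBlock j m)

/-- The number of columns of a block. -/
def blockWidth (n j : ℕ) (k : Fin 5) : ℕ := if k = 4 then n - 4 * (j + 2) else j + 2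

lemma le_blockWidth {n j : ℕ} (hnj : 5 * (j + 2) ≤ n) (k : Fin 5) : j + 2 ≤ blockWidth n j k := by
  unfold blockWidth; split_ifs <;> omega

lemma even_blockWidth {n j : ℕ} (hn : Even n) (hj : Even j) (k : Fin 5) :
    Even (blockWidth n j k) := by
  unfold blockWidth; split_ifs <;> grind

lemma even_columnOffset_iff {j : ℕ} (hj : Even j) (m : ℕ) :
    Even (columnOffset j m) ↔ Even m := by
  obtain ⟨i, rfl⟩ := hj
  unfold columnOffset columnBlock blockStart
  simp only [Nat.even_iff]
  split_ifs <;> simp <;> omega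

lemma columnOffset_lt {n j m : ℕ} (hnj : 5 * (j + 2) ≤ n) (hm : m < n) :
    columnOffset j m < blockWidth n j (columnBlock j m) := by
  unfold columnOffset columnBlock blockStart blockWidth
  split_ifs <;> simp_all <;> omega

lemma columnBlock_blockStart_add {n j : ℕ} (hnj : 5 * (j + 2) ≤ n) (k : Fin 5) {l : ℕ}
    (hl : l < blockWidth n j k) :
    blockStart j k + l < n ∧ columnBlock j (blockStart j k + l) = k ∧
      columnOffset j (blockStart j k + l) = l := by
  have h : blockStart j k + l < n ∧ columnBlock j (blockStart j k + l) = k := by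
    unfold columnBlock blockStart blockWidth at *
    fin_cases k <;> simp at hl ⊢ <;> split_ifs <;> simp <;> omega
  exact ⟨h.1, h.2, by rw [columnOffset, h.2]; omega⟩

lemma blockStart_add_columnOffset (j m : ℕ) :
    blockStart j (columnBlock j m) + columnOffset j m = m := by
  unfold columnOffset columnBlock blockStart
  split_ifs <;> simp <;> omega

/-- Moving `d` columns to the right, `d ≤ j + 2`, stays in the block or enters the next one. -/
lemma columnBlock_add {n j : ℕ} (hnj : 5 * (j + 2) ≤ n) {m d : ℕ} (hm : m < n)
    (hd : d ≤ j + 2) :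
    (columnBlock j ((m + d) % n) = columnBlock j m ∧
      columnOffset j ((m + d) % n) = columnOffset j m + d) ∨
    (columnBlock j ((m + d) % n) = columnBlock j m + 1 ∧
      columnOffset j ((m + d) % n) + blockWidth n j (columnBlock j m) = columnOffset j m + d) := by
  have hstart := blockStart_add_columnOffset j m
  have hlt := columnOffset_lt hnj hm
  generalize columnBlock j m = k at *
  generalize columnOffset j m = l at *
  subst hstart
  have hmod : ∀ k' l', l' < blockWidth n j k' →
      blockStart j k + l + d = blockStart j k' + l' ∨
        blockStart j k + l + d = blockStart j k' + l' + n →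
      columnBlock j ((blockStart j k + l + d) % n) = k' ∧
        columnOffset j ((blockStart j k + l + d) % n) = l' := by
    intro k' l' hl' h
    have := columnBlock_blockStart_add hnj k' hl'
    rcases h with h | h
    · rw [h, Nat.mod_eq_of_lt this.1]; exact this.2
    · rw [h, Nat.add_mod_right, Nat.mod_eq_of_lt this.1]; exact this.2
  by_cases h : l + d < blockWidth n j k
  · exact .inl (hmod k (l + d) h (.inl (by omega)))
  · right
    have hw := le_blockWidth hnj (k + 1)
    have hnext : blockStart j k + blockWidth n j k = blockStart j (k + 1) ∨
        blockStart j k + blockWidth n j k = blockStart j (k + 1) + n := by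
      unfold blockStart blockWidth
      fin_cases k <;> simp <;> omega
    have := hmod (k + 1) (l + d - blockWidth n j k) (by omega) (by omega)
    exact ⟨this.1, by omega⟩

/-- The other end of the spoke at a vertex. -/
def spokeEnd (n j : ℕ) (v : Fin 2 × ZMod n) : Fin 2 × ZMod n :=
  if v.1 = 0 then (1, if Even v.2.val then v.2 else v.2 + j)
  else (0, if Even v.2.val then v.2 else v.2 - j)

lemma even_val_add_even {n d : ℕ} [NeZero n] (hn : Even n) (hd : Even d) (a : ZMod n) :
    Even (a + (d : ZMod n)).val ↔ Even a.val := by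
  rw [ZMod.val_add, ZMod.val_natCast, Nat.add_mod_mod]
  have h1 : Even ((a.val + d) % n) ↔ Even (a.val + d) := by
    rw [Nat.even_iff, Nat.even_iff, Nat.mod_mod_of_dvd _ hn.two_dvd]
  rw [h1, Nat.even_add]
  simp [hd]

lemma even_val_sub_even {n d : ℕ} [NeZero n] (hn : Even n) (hd : Even d) (a : ZMod n) :
    Even (a - (d : ZMod n)).val ↔ Even a.val := by
  rw [← even_val_add_even hn hd (a - d), sub_add_cancel]

lemma zeroPrism_adj_iff {n j : ℕ} (hn : Even n) (hj : Even j) (hn1 : 1 < n)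
    (v w : Fin 2 × ZMod n) :
    (zeroPrism n j).Adj v w ↔ w = (v.1, v.2 + 1) ∨ w = (v.1, v.2 - 1) ∨ w = spokeEnd n j v := by
  have : NeZero n := ⟨by omega⟩
  have : Fact (1 < n) := ⟨hn1⟩
  have h1 : (1 : ZMod n) ≠ 0 := one_ne_zero
  obtain ⟨i, a⟩ := v
  rw [zeroPrism, SimpleGraph.fromRel_adj]
  constructor
  · rintro ⟨-, h | h⟩
    · cases h with
      | rim => simp
      | spokeZero _ ha => simp [spokeEnd, ha]
      | spokeJ _ ha => simp [spokeEnd, ha]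
    · cases h with
      | rim => simp
      | spokeZero _ ha => simp [spokeEnd, ha]
      | spokeJ b ha =>
        have := even_val_add_even hn hj b
        simp [spokeEnd, ha, this]
  · rintro (rfl | rfl | rfl)
    · exact ⟨by simp, .inl (.rim _ _)⟩
    · refine ⟨by simp [eq_sub_iff_add_eq], .inr ?_⟩
      have h := PrismEdge.rim (j := j) i (a - 1)
      rwa [sub_add_cancel] at h
    · by_cases ha : Even a.val
      · fin_cases i
        · simpa [spokeEnd, ha] using Or.inl (PrismEdge.spokeZero (j := j) a ha)
        · simpa [spokeEnd, ha] using Or.inr (PrismEdge.spokeZero (j := j) a ha)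
      · have hb := even_val_sub_even hn hj a
        fin_cases i
        · simpa [spokeEnd, ha] using Or.inl (PrismEdge.spokeJ (j := j) a (by simpa using ha))
        · simpa [spokeEnd, ha] using
            Or.inr (PrismEdge.spokeJ (j := j) (a - (j : ZMod n)) (by
              rw [← Nat.not_even_iff_odd, hb]; exact ha))

/-! ### A coloring with five colors -/

/-- The role of the vertex at position `l` of a block, on the first rim (`i = 0`) or the second
one. In each block the vertex of role `1` at position `2` is the center, whose color cannot be
removed. -/
def prismRole (i : Fin 2) (l : ℕ) : Fin 5 :=
  if i = 0 then (if l = 0 then 3 else if l = 1 then 2 else if Even l then 1 else 0)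
  else (if Even l then 2 else if l = 1 then 3 else 4)

/-- The coloring: role `r` in block `k` has color `r - k`, so that a color changes its role from
`r` to `r + 1` on passing to the next block. -/
def prismColoring (n j : ℕ) (v : Fin 2 × ZMod n) : Fin 5 :=
  prismRole v.1 (columnOffset j v.2.val) - columnBlock j v.2.val

/-- The rank of a vertex at position `l` of a block. It grows to the right along the rims, except
that position `1` of the first rim gets the lowest rank: each of the three neighbors of this vertex
has another neighbor of the same color. -/
def positionRank (i : Fin 2) (l : ℕ) : ℕ :=
  if i = 0 then (if l = 0 then 1 else if l = 1 then 0 else l) else l + 2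

/-- A rank function with which the coloring satisfies `isAcyclicColoring_of_rank`. -/
def prismRank (n j : ℕ) (v : Fin 2 × ZMod n) : ℕ := positionRank v.1 (columnOffset j v.2.val)

lemma columnBlock_val_add {n j : ℕ} [NeZero n] (hnj : 5 * (j + 2) ≤ n) {d : ℕ} (hd : d ≤ j + 2)
    (a : ZMod n) :
    (columnBlock j (a + (d : ZMod n)).val = columnBlock j a.val ∧
      columnOffset j (a + (d : ZMod n)).val = columnOffset j a.val + d) ∨
    (columnBlock j (a + (d : ZMod n)).val = columnBlock j a.val + 1 ∧
      columnOffset j (a + (d : ZMod n)).val + blockWidth n j (columnBlock j a.val)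
        = columnOffset j a.val + d) := by
  have h := columnBlock_add hnj (ZMod.val_lt a) hd
  rwa [← Nat.add_mod_mod, ← ZMod.val_natCast n d, ← ZMod.val_add] at h

/-- Color `c` and rank `f` of a vertex, against those of its three neighbors: the coloring is proper
there, and of two neighbors of one color at least one has lower rank. -/
def IsRankedAt {α : Type*} (c : α) (f : ℕ) (c₁ : α) (f₁ : ℕ) (c₂ : α) (f₂ : ℕ) (c₃ : α) (f₃ : ℕ) :
    Prop :=
  (c ≠ c₁ ∧ c ≠ c₂ ∧ c ≠ c₃) ∧ (c₁ = c₂ → f₁ < f ∨ f₂ < f) ∧ (c₁ = c₃ → f₁ < f ∨ f₃ < f) ∧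
    (c₂ = c₃ → f₂ < f ∨ f₃ < f)

lemma sub_eq_sub_add_fin_five :
    (∀ k r r' : Fin 5, r - k = r' - k ↔ r = r') ∧
    (∀ k r r' : Fin 5, r - (k + 1) = r' - k ↔ r = r' + 1) ∧
    ∀ k r r' : Fin 5, r - k = r' - (k + 1) ↔ r + 1 = r' := by
  decide

set_option maxHeartbeats 400000 in
-- The case analysis is over the positions of four vertices relative to two block borders.
/-- The ranking condition at position `l` of block `k` on the first rim. The indices `R`, `L`, `S`
refer to the neighbors to the right, to the left and along the spoke. -/
lemma isRankedAt_first_rim {j : ℕ} (hj : Even j) (hj0 : 0 < j) {k kR kL kS : Fin 5}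
    {l lR lL lS w wL : ℕ} (hw : Even w) (hwL : Even wL) (hle : j + 2 ≤ w) (hleL : j + 2 ≤ wL)
    (hl : l < w) (hlL : lL < wL)
    (hR : kR = k ∧ lR = l + 1 ∨ kR = k + 1 ∧ lR + w = l + 1)
    (hL : k = kL ∧ l = lL + 1 ∨ k = kL + 1 ∧ l + wL = lL + 1)
    (hS : Even l ∧ kS = k ∧ lS = l ∨
      ¬ Even l ∧ (kS = k ∧ lS = l + j ∨ kS = k + 1 ∧ lS + w = l + j)) :
    IsRankedAt (prismRole 0 l - k) (positionRank 0 l)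
      (prismRole 0 lR - kR) (positionRank 0 lR) (prismRole 0 lL - kL) (positionRank 0 lL)
      (prismRole 1 lS - kS) (positionRank 1 lS) := by
  obtain ⟨e1, e2, e3⟩ := sub_eq_sub_add_fin_five
  simp only [prismRole, positionRank, Nat.even_iff, IsRankedAt, Fin.isValue, if_true, if_false,
    one_ne_zero] at *
  rcases hL with ⟨hkL, hlL⟩ | ⟨hkL, hlL⟩ <;> rcases hR with ⟨hkR, hlR⟩ | ⟨hkR, hlR⟩ <;>
    rcases hS with ⟨hp, hkS, hlS⟩ | ⟨hp, ⟨hkS, hlS⟩ | ⟨hkS, hlS⟩⟩ <;> try (exfalso; omega)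
  all_goals
    subst hkL hkR hkS
    simp only [ne_eq, e1, e2, e3]
    clear e1 e2 e3
    refine ⟨⟨?_, ?_, ?_⟩, ?_, ?_, ?_⟩ <;> grind

set_option maxHeartbeats 400000 in
-- The case analysis is over the positions of four vertices relative to two block borders.
/-- The ranking condition at position `l` of block `k` on the second rim. -/
lemma isRankedAt_second_rim {j : ℕ} (hj : Even j) (hj0 : 0 < j) {k kR kL kS : Fin 5}
    {l lR lL lS w wL wS : ℕ} (hw : Even w) (hwL : Even wL) (hwS : Even wS)
    (hle : j + 2 ≤ w) (hleL : j + 2 ≤ wL) (hleS : j + 2 ≤ wS)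
    (hl : l < w) (hlL : lL < wL) (hlS : lS < wS)
    (hR : kR = k ∧ lR = l + 1 ∨ kR = k + 1 ∧ lR + w = l + 1)
    (hL : k = kL ∧ l = lL + 1 ∨ k = kL + 1 ∧ l + wL = lL + 1)
    (hS : Even l ∧ kS = k ∧ lS = l ∨
      ¬ Even l ∧ (k = kS ∧ l = lS + j ∨ k = kS + 1 ∧ l + wS = lS + j)) :
    IsRankedAt (prismRole 1 l - k) (positionRank 1 l)
      (prismRole 1 lR - kR) (positionRank 1 lR) (prismRole 1 lL - kL) (positionRank 1 lL)
      (prismRole 0 lS - kS) (positionRank 0 lS) := by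
  obtain ⟨e1, e2, e3⟩ := sub_eq_sub_add_fin_five
  simp only [prismRole, positionRank, Nat.even_iff, IsRankedAt, Fin.isValue, if_true, if_false,
    one_ne_zero] at *
  rcases hL with ⟨hkL, hlL⟩ | ⟨hkL, hlL⟩ <;> rcases hR with ⟨hkR, hlR⟩ | ⟨hkR, hlR⟩ <;>
    rcases hS with ⟨hp, hkS, hlS⟩ | ⟨hp, ⟨hkS, hlS⟩ | ⟨hkS, hlS⟩⟩ <;> try (exfalso; omega)
  all_goals
    subst hkL hkR hkS
    simp only [ne_eq, e1, e2, e3]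
    clear e1 e2 e3
    refine ⟨⟨?_, ?_, ?_⟩, ?_, ?_, ?_⟩ <;> grind

lemma prismColoring_rank {n j : ℕ} (hn : Even n) (hj : Even j) (hj0 : 0 < j)
    (hnj : 5 * (j + 2) ≤ n) (v : Fin 2 × ZMod n) :
    (∀ u, (zeroPrism n j).Adj v u → prismColoring n j v ≠ prismColoring n j u) ∧
    ∀ u w, (zeroPrism n j).Adj v u → (zeroPrism n j).Adj v w → u ≠ w →
      prismColoring n j u = prismColoring n j w →
      prismRank n j u < prismRank n j v ∨ prismRank n j w < prismRank n j v := by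
  have : NeZero n := ⟨by omega⟩
  have hle := le_blockWidth hnj
  have hev := even_blockWidth hn hj
  have hlt : ∀ x : ZMod n, columnOffset j x.val < blockWidth n j (columnBlock j x.val) :=
    fun x => columnOffset_lt hnj (ZMod.val_lt x)
  have hR := fun a : ZMod n => columnBlock_val_add hnj (d := 1) (by omega) a
  have hL := fun a : ZMod n => columnBlock_val_add hnj (d := 1) (by omega) (a - 1)
  have hS := fun a : ZMod n => columnBlock_val_add hnj (d := j) (by omega) a
  have hS' := fun a : ZMod n => columnBlock_val_add hnj (d := j) (by omega) (a - j)
  simp only [Nat.cast_one, sub_add_cancel] at hR hL hS'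
  have key : IsRankedAt (prismColoring n j v) (prismRank n j v)
      (prismColoring n j (v.1, v.2 + 1)) (prismRank n j (v.1, v.2 + 1))
      (prismColoring n j (v.1, v.2 - 1)) (prismRank n j (v.1, v.2 - 1))
      (prismColoring n j (spokeEnd n j v)) (prismRank n j (spokeEnd n j v)) := by
    obtain ⟨i, a⟩ := v
    have hpar := even_columnOffset_iff hj a.val
    obtain rfl | rfl : i = 0 ∨ i = 1 := by omega
    · refine isRankedAt_first_rim hj hj0 (hev _) (hev _) (hle _) (hle _) (hlt _) (hlt _)
        (hR a) (hL a) ?_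
      by_cases hp : Even a.val
      · simp [hpar, hp, spokeEnd]
      · simpa [hpar, hp, spokeEnd] using hS a
    · refine isRankedAt_second_rim hj hj0 (hev _) (hev _) (hev _) (hle _) (hle _) (hle _) (hlt _)
        (hlt _) (hlt (if Even a.val then a else a - j)) (hR a) (hL a) ?_
      by_cases hp : Even a.val
      · simp [hpar, hp, spokeEnd]
      · simpa [hpar, hp, spokeEnd] using hS' a
  simp only [zeroPrism_adj_iff hn hj (by omega) v]
  generalize prismRank n j = f at *
  generalize prismColoring n j = c at *
  unfold IsRankedAt at key
  clear * - key
  grind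

/-! ### No color can be removed -/

/-- The vertex at position `d` of block `k`, on the rim `i`. -/
def blockVertex (n j : ℕ) (k : Fin 5) (i : Fin 2) (d : ℕ) : Fin 2 × ZMod n :=
  (i, ((blockStart j k + d : ℕ) : ZMod n))

lemma prismColoring_blockVertex {n j : ℕ} (hnj : 5 * (j + 2) ≤ n) (k : Fin 5) (i : Fin 2) {d : ℕ}
    (hd : d < j + 2) : prismColoring n j (blockVertex n j k i d) = prismRole i d - k := by
  obtain ⟨h1, h2, h3⟩ :=
    columnBlock_blockStart_add hnj k (hd.trans_le (le_blockWidth hnj k))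
  simp only [prismColoring, blockVertex, ZMod.val_cast_of_lt h1, h2, h3]

lemma blockVertex_adj_succ {n j : ℕ} (hn1 : 1 < n) (k : Fin 5) (i : Fin 2) (d : ℕ) :
    (zeroPrism n j).Adj (blockVertex n j k i d) (blockVertex n j k i (d + 1)) := by
  have : Fact (1 < n) := ⟨hn1⟩
  have h := PrismEdge.rim (j := j) i ((blockStart j k + d : ℕ) : ZMod n)
  rw [zeroPrism, SimpleGraph.fromRel_adj]
  refine ⟨by simp [blockVertex, ← add_assoc], .inl ?_⟩
  simpa only [blockVertex, ← add_assoc, Nat.cast_add, Nat.cast_one] using h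

lemma blockVertex_adj_spokeZero {n j : ℕ} (hj : Even j) (hnj : 5 * (j + 2) ≤ n) (k : Fin 5) {d : ℕ}
    (hd : d < j + 2) (hpar : Even d) :
    (zeroPrism n j).Adj (blockVertex n j k 0 d) (blockVertex n j k 1 d) := by
  have h1 := (columnBlock_blockStart_add hnj k (hd.trans_le (le_blockWidth hnj k))).1
  rw [zeroPrism, SimpleGraph.fromRel_adj]
  refine ⟨by simp [blockVertex], .inl (.spokeZero _ ?_)⟩
  rw [ZMod.val_cast_of_lt h1, blockStart]
  grind

lemma blockVertex_adj_spokeJ {n j : ℕ} (hj : Even j) (hnj : 5 * (j + 2) ≤ n) (k : Fin 5) {d : ℕ}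
    (hd : d < j + 2) (hpar : Odd d) :
    (zeroPrism n j).Adj (blockVertex n j k 0 d) (blockVertex n j k 1 (d + j)) := by
  have h1 := (columnBlock_blockStart_add hnj k (hd.trans_le (le_blockWidth hnj k))).1
  have h := PrismEdge.spokeJ (j := j) ((blockStart j k + d : ℕ) : ZMod n) (by
    rw [ZMod.val_cast_of_lt h1, blockStart]
    grind)
  rw [zeroPrism, SimpleGraph.fromRel_adj]
  refine ⟨by simp [blockVertex], .inl ?_⟩
  simpa only [blockVertex, ← add_assoc, Nat.cast_add] using h

/-- The center of block `1 - i` keeps the color `i`: its neighbors forbid the roles `0` and `2`, a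
hexagon forbids role `3`, and the path from position `2` to position `j + 1` on the second rim,
closed up by a spoke of type `j`, forbids role `4`. -/
lemma prismColoring_not_step {n j : ℕ} (hj : Even j) (hj0 : 0 < j) (hnj : 5 * (j + 2) ≤ n)
    (i : Fin 5) (c' : Fin 2 × ZMod n → Fin 5) :
    ¬ IsAcyclicRecoloringStep (zeroPrism n j) (prismColoring n j) i c' := by
  rintro ⟨hkeep, hremove, hproper, hacyc⟩
  have hj2 : 2 ≤ j := by grind
  obtain ⟨k, rfl⟩ : ∃ k : Fin 5, i = 1 - k := ⟨1 - i, by simp⟩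
  have hc : ∀ i d, d < j + 2 → prismRole i d ≠ 1 →
      c' (blockVertex n j k i d) = prismRole i d - k := by
    intro i d hd hne
    rw [← prismColoring_blockVertex hnj k i hd]
    apply hkeep
    rw [prismColoring_blockVertex hnj k i hd]
    simpa using hne
  have hadj := fun i d => blockVertex_adj_succ (n := n) (j := j) (by omega) k i d
  have hzero := fun d => blockVertex_adj_spokeZero hj hnj k (d := d)
  have hspoke := blockVertex_adj_spokeJ hj hnj k (d := 1) (by omega) (by decide)
  obtain ⟨r, hr⟩ : ∃ r : Fin 5, c' (blockVertex n j k 0 2) = r - k :=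
    ⟨c' (blockVertex n j k 0 2) + k, by simp⟩
  have hr1 : r ≠ 1 := by
    rintro rfl
    exact hremove _ hr
  have hr0 : r ≠ 0 := by
    rintro rfl
    have h := hc 0 3 (by omega) (by decide)
    exact hproper _ _ (hadj 0 2) (hr.trans h.symm)
  have hr2 : r ≠ 2 := by
    rintro rfl
    have h := hc 0 1 (by omega) (by decide)
    exact hproper _ _ (hadj 0 1) (h.trans hr.symm)
  let T : Set (Fin 2 × ZMod n) := {x | c' x = 2 - k ∨ c' x = r - k}
  have hmem : ∀ i d, d < j + 2 → prismRole i d = 2 ∨ prismRole i d = r →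
      blockVertex n j k i d ∈ T \ {blockVertex n j k 0 2} := by
    intro i d hd h
    have hne : prismRole i d ≠ 1 := by rintro h'; simp [h', hr1.symm] at h
    refine ⟨?_, fun heq => ?_⟩
    · change _ ∨ _
      rw [hc i d hd hne]
      simpa using h
    · rw [Set.mem_singleton_iff] at heq
      have h1 := prismColoring_blockVertex hnj k i hd
      rw [heq, prismColoring_blockVertex hnj k 0 (by omega)] at h1
      exact hne (sub_left_injective h1).symm
  have hstep : ∀ {x y} (hx : x ∈ T \ {blockVertex n j k 0 2})
      (hy : y ∈ T \ {blockVertex n j k 0 2}), (zeroPrism n j).Adj x y →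
      ((zeroPrism n j).induce (T \ {blockVertex n j k 0 2})).Reachable ⟨x, hx⟩ ⟨y, hy⟩ :=
    fun hx hy h => SimpleGraph.Adj.reachable (by exact h)
  have ht := hmem 1 2 (by omega) (.inl (by decide))
  have hu := hmem 0 1 (by omega) (.inl (by decide))
  refine not_isAcyclic_induce_of_reachable (s := T) (.inr hr) ht hu (hzero 2 (by omega) (by decide))
    (hadj 0 1).symm (by simp [blockVertex]) ?_ (hacyc (2 - k) (r - k))
  obtain rfl | rfl : r = 3 ∨ r = 4 := by omega
  · have h11 := hmem 1 1 (by omega) (.inr (by decide))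
    have h10 := hmem 1 0 (by omega) (.inl (by decide))
    have h00 := hmem 0 0 (by omega) (.inr (by decide))
    exact (hstep ht h11 (hadj 1 1).symm).trans <| (hstep h11 h10 (hadj 1 0).symm).trans <|
      (hstep h10 h00 (hzero 0 (by omega) (by decide)).symm).trans (hstep h00 hu (hadj 0 0))
  · have hrim : ∀ d, 2 ≤ d → d < j + 2 →
        blockVertex n j k 1 d ∈ T \ {blockVertex n j k 0 2} := by
      intro d hd2 hd
      apply hmem 1 d hd
      rcases Nat.even_or_odd d with h | h
      · simp [prismRole, h]
      · simp [prismRole, Nat.not_even_iff_odd.2 h, show d ≠ 1 by omega]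
    have hpath : ∀ d (hd2 : 2 ≤ d) (hd : d < j + 2),
        ((zeroPrism n j).induce (T \ {blockVertex n j k 0 2})).Reachable
          ⟨_, ht⟩ ⟨_, hrim d hd2 hd⟩ := by
      intro d hd2
      induction d, hd2 using Nat.le_induction with
      | base => exact fun _ => .refl _
      | succ d hd2 ih =>
        exact fun hd => (ih (by omega)).trans
          (hstep (hrim d hd2 (by omega)) (hrim (d + 1) (by omega) hd) (hadj 1 d))
    have hlast : blockVertex n j k 1 (1 + j) ∈ T \ {blockVertex n j k 0 2} :=
      hrim (1 + j) (by omega) (by omega)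
    exact (hpath (1 + j) (by omega) (by omega)).trans (hstep hlast hu hspoke.symm)

theorem mainTheorem7 (n j : ℕ) (hn : Even n) (hj : Even j) (hj0 : 0 < j)
    (hnj : 5 * (j + 2) ≤ n) :
    acyclicBChromaticNumber (zeroPrism n j) = 5 := by
  have : NeZero n := ⟨by omega⟩
  refine IsGreatest.csSup_eq ⟨⟨prismColoring n j, ?_, ?_⟩, ?_⟩
  · exact isAcyclicColoring_of_rank _ (prismRank n j)
      (fun u => (prismColoring_rank hn hj hj0 hnj u).1)
      (fun v => (prismColoring_rank hn hj hj0 hnj v).2)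
  · exact prismColoring_not_step hj hj0 hnj
  · rintro k ⟨c, hc⟩
    exact hc.card_le_five fun v => ⟨_, _, _, zeroPrism_adj_iff hn hj (by omega) v⟩
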